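/- Let $k$ be a field of characteristic $0$ and let $n_1<n_2<n_3$ be positive integers with $\gcd(n_1,n_2,n_3)=1$ that minimally generate the numerical semigroup $G=\langle n_1,n_2,n_3\rangle$ (no $n_i$ is a non-negative integer combination of the other two). Let $R=k[[t^{n_1},t^{n_2},t^{n_3}]]\subseteq k[[t]]$, with maximal ideal $\mathfrak m=(t^{n_1},t^{n_2},t^{n_3})R$, let $S=k[[x_1,x_2,x_3]]$, with maximal ideal $\mathfrak n=(x_1,x_2,x_3)S$, and let $S\to R$, $x_i\mapsto t^{n_i}$, be the natural surjection, with kernel $I$. Let the initial form ideal $I^*\subseteq \operatorname{gr}_{\mathfrak n}(S)$ be the kernel of the induced map of associated graded rings $\operatorname{gr}_{\mathfrak n}(S)\to\operatorname{gr}_{\mathfrak m}(R)$. Let $\mathcal M=\bigoplus_{i\ge 1}\mathfrak m^i/\mathfrak m^{i+1}$ be the homogeneous maximal ideal of $\operatorname{gr}_{\mathfrak m}(R)$, and let $H^0_{\mathcal M}(\operatorname{gr}_{\mathfrak m}(R))$ be the ideal of all elements of $\operatorname{gr}_{\mathfrak m}(R)$ that are annihilated by some power of $\mathcal M$. If $\operatorname{gr}_{\mathfrak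 m}(R)$ is $2$-Buchsbaum, that is, if $\mathcal M^2\cdot H^0_{\mathcal M}(\operatorname{gr}_{\mathfrak m}(R))=0$, then $I^*$ is generated by $4$ elements (not necessarily a minimal generating set). -/

import Mathlib

noncomputable section

namespace SemigroupRing

/-! ### The associated graded ring of an ideal -/

section AssociatedGraded

variable {A B : Type*} [CommRing A] [CommRing B]

/-- The associated graded ring `gr_J(A) = ⨁ Jⁱ / Jⁱ⁺¹`, presented as the quotient
`A[JT] / J A[JT]` of the Rees algebra `A[JT] = ⨁ Jⁱ Tⁱ`. -/
def Gr (J : Ideal A) : Type _ :=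
  reesAlgebra J ⧸ J.map (algebraMap A (reesAlgebra J))

instance (J : Ideal A) : CommRing (Gr J) :=
  inferInstanceAs (CommRing (reesAlgebra J ⧸ J.map (algebraMap A (reesAlgebra J))))

/-- The quotient map `A[JT] → gr_J(A)`; it sends `a Tⁱ` with `a ∈ Jⁱ` to the class of `a` in
`Jⁱ / Jⁱ⁺¹`. -/
def grMk (J : Ideal A) : reesAlgebra J →+* Gr J :=
  Ideal.Quotient.mk (J.map (algebraMap A (reesAlgebra J)))

/-- The ideal `⨁_{i ≥ 1} Jⁱ / Jⁱ⁺¹` of `gr_J(A)` of all elements without degree-zero part, i.e. the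
image of the ideal `⨁_{i ≥ 1} Jⁱ Tⁱ` of the Rees algebra. When `J` is a maximal ideal, so that the
degree-zero part `A / J` is a field, this is the homogeneous maximal ideal of `gr_J(A)`. -/
def grIrrelevant (J : Ideal A) : Ideal (Gr J) :=
  (RingHom.ker ((Polynomial.constantCoeff : Polynomial A →+* A).comp
    (reesAlgebra J).val.toRingHom)).map (grMk J)

theorem map_mem_reesAlgebra (f : A →+* B) {I : Ideal A} {J : Ideal B} (h : I.map f ≤ J)
    {p : Polynomial A} (hp : p ∈ reesAlgebra I) : p.map f ∈ reesAlgebra J := by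
  intro i
  rw [Polynomial.coeff_map]
  have h1 : f (p.coeff i) ∈ (I ^ i).map f := Ideal.mem_map_of_mem f (hp i)
  rw [Ideal.map_pow] at h1
  exact Ideal.pow_right_mono h i h1

/-- The ring homomorphism `A[IT] → B[JT]`, `∑ aᵢ Tⁱ ↦ ∑ f(aᵢ) Tⁱ`, for `f : A → B` with
`f(I) ⊆ J`. -/
def reesMap (f : A →+* B) {I : Ideal A} {J : Ideal B} (h : I.map f ≤ J) :
    reesAlgebra I →+* reesAlgebra J :=
  ((Polynomial.mapRingHom f).comp (reesAlgebra I).val.toRingHom).codRestrict (reesAlgebra J)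
    (fun p => map_mem_reesAlgebra f h p.2)

theorem reesMap_map_le (f : A →+* B) {I : Ideal A} {J : Ideal B} (h : I.map f ≤ J) :
    I.map (algebraMap A (reesAlgebra I)) ≤
      (J.map (algebraMap B (reesAlgebra J))).comap (reesMap f h) := by
  rw [Ideal.map_le_iff_le_comap]
  intro a ha
  have h1 : reesMap f h (algebraMap A (reesAlgebra I) a) =
      algebraMap B (reesAlgebra J) (f a) := by
    apply Subtype.ext
    change Polynomial.map f (Polynomial.C a) = Polynomial.C (f a)
    exact Polynomial.map_C f
  rw [Ideal.mem_comap, Ideal.mem_comap, h1]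
  exact Ideal.mem_map_of_mem _ (h (Ideal.mem_map_of_mem f ha))

/-- The natural map `gr_I(A) → gr_J(B)` induced by `f : A → B` with `f(I) ⊆ J`. -/
def grMap (f : A →+* B) {I : Ideal A} {J : Ideal B} (h : I.map f ≤ J) : Gr I →+* Gr J :=
  Ideal.quotientMap _ (reesMap f h) (reesMap_map_le f h)

end AssociatedGraded

/-! ### The `k`-Buchsbaum property -/

section Buchsbaum

variable {A : Type*} [CommRing A]

/-- The zeroth local cohomology `H⁰_M(A)`, i.e. the ideal of all elements of `A` that are
annihilated by some power of `M`. -/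
def zerothLocalCohomology (M : Ideal A) : Ideal A where
  carrier := {x | ∃ N : ℕ, ∀ y ∈ M ^ N, y * x = 0}
  zero_mem' := ⟨0, fun y _ => mul_zero y⟩
  add_mem' := by
    rintro a b ⟨N, hN⟩ ⟨N', hN'⟩
    refine ⟨N + N', fun y hy => ?_⟩
    rw [mul_add, hN y (Ideal.pow_le_pow_right (Nat.le_add_right N N') hy),
      hN' y (Ideal.pow_le_pow_right (Nat.le_add_left N' N) hy), add_zero]
  smul_mem' := by
    rintro c x ⟨N, hN⟩
    refine ⟨N, fun y hy => ?_⟩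
    rw [smul_eq_mul, mul_left_comm, hN y hy, mul_zero]

/-- `r`-Buchsbaum with respect to the (homogeneous maximal) ideal `M`: `M^r · H⁰_M(A) = 0`. -/
def IsKBuchsbaum (r : ℕ) (M : Ideal A) : Prop :=
  M ^ r * zerothLocalCohomology M = ⊥

end Buchsbaum

/-! ### Numerical semigroup rings -/

/-- `n 0 < n 1 < ⋯` are positive, have greatest common divisor `1`, and minimally generate the
numerical semigroup of their `ℕ`-linear combinations. -/
structure IsMinimalGeneratingSequence {d : ℕ} (n : Fin d → ℕ) : Prop where
  pos : ∀ i, 0 < n i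
  strictMono : StrictMono n
  gcd_eq_one : Finset.univ.gcd n = 1
  minimal : ∀ i, n i ∉ AddSubmonoid.closure (n '' {i}ᶜ)

theorem hasSubst_X_pow (k : Type*) [Field k] {d : ℕ} (n : Fin d → ℕ) (hn : ∀ i, 0 < n i) :
    MvPowerSeries.HasSubst (fun i => (PowerSeries.X ^ n i : PowerSeries k)) :=
  MvPowerSeries.hasSubst_of_constantCoeff_zero fun i => by
    have h : PowerSeries.constantCoeff (PowerSeries.X ^ n i : PowerSeries k) = 0 := by
      rw [map_pow, PowerSeries.constantCoeff_X, zero_pow (hn i).ne']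
    exact h

variable (k : Type*) [Field k] {d : ℕ} (n : Fin d → ℕ) (hn : ∀ i, 0 < n i)

/-- The `k`-algebra homomorphism `S = k⟦x₁, …, x_d⟧ → k⟦t⟧` with `xᵢ ↦ t^{nᵢ}`, i.e. substitution
of `t^{nᵢ}` for `xᵢ`. -/
def paramHom : MvPowerSeries (Fin d) k →ₐ[k] PowerSeries k :=
  MvPowerSeries.substAlgHom (hasSubst_X_pow k n hn)

/-- The numerical semigroup ring `R = k⟦t^{n₁}, …, t^{n_d}⟧ ⊆ k⟦t⟧`. -/
abbrev semigroupRing : Subalgebra k (PowerSeries k) := (paramHom k n hn).range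

/-- The surjection `S → R`. -/
def toSemigroupRing : MvPowerSeries (Fin d) k →+* semigroupRing k n hn :=
  (paramHom k n hn).rangeRestrict.toRingHom

/-- The maximal ideal `𝔫 = (x₁, …, x_d)` of `S`. -/
def idealN (d : ℕ) : Ideal (MvPowerSeries (Fin d) k) :=
  Ideal.span (Set.range MvPowerSeries.X)

/-- The maximal ideal `𝔪 = (t^{n₁}, …, t^{n_d}) R` of `R`, where `t^{nᵢ}` is the image of `xᵢ`. -/
def idealM : Ideal (semigroupRing k n hn) :=
  Ideal.span (Set.range fun i => toSemigroupRing k n hn (MvPowerSeries.X i))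

theorem coe_toSemigroupRing_X (i : Fin d) :
    (toSemigroupRing k n hn (MvPowerSeries.X i) : PowerSeries k) = PowerSeries.X ^ n i :=
  MvPowerSeries.substAlgHom_X (hasSubst_X_pow k n hn) i

theorem map_idealN_le : (idealN k d).map (toSemigroupRing k n hn) ≤ idealM k n hn := by
  rw [idealN, idealM, Ideal.map_span, ← Set.range_comp]
  exact le_rfl

/-- The initial form ideal `I^*` of `I = ker (S → R)`: the kernel of the natural map
`gr_𝔫(S) → gr_𝔪(R)`. -/
def initialFormIdeal : Ideal (Gr (idealN k d)) :=
  RingHom.ker (grMap (toSemigroupRing k n hn) (map_idealN_le k n hn))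

end SemigroupRing

end

noncomputable section

namespace SemigroupRing

/-! Write x, y, z for the degree-one classes and A < B < C for the three weights. A monomial
vanishes in gr_m(R) exactly when its weight is also a sum of more generators than its degree
(`HasLongerRep`), and I^* is generated by these monomials together with the differences of monomials
of equal degree and weight (`initialFormIdeal_eq`). The rest is combinatorics of exponents.

No power of x vanishes, and a vanishing monomial has a vanishing factor x^a z^c or y^b z^c
(`left_or_middle`). All homogeneous binomials come from one primitive relation x^p z^r - y^q
(`exists_homogeneous_relation`). So I^* is governed by two staircases, in the (x,z)- and the
(y,z)-plane.

If x^a z^c = 0, then z^c lies in H^0_M, since some powers of y and z kill it anyway; the 2-Buchsbaum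
property then gives M^2 z^c = 0 (`hasLongerRep_of_isKBuchsbaum`). Apart from the pure powers z^γ and
y^β this leaves one corner in the (x,z)-plane (`exists_corner_left`) and, modulo the binomial, one
in the (y,z)-plane (`exists_corner_right`): the weight of a corner is a multiple of the missing
generator, and subtracting two such equations produces a relation that is too small. Finally y^β and
the binomial are never both needed, so four generators suffice (`exists_four_generators`). -/

/-- The integer `a * A + b * B + c * C` has a representation by `A, B, C` with more summands. -/
def HasLongerRep (A B C a b c : ℕ) : Prop :=
  ∃ a' b' c' : ℕ, a' * A + b' * B + c' * C = a * A + b * B + c * C ∧ a + b + c < a' + b' + c'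

/-! ### Combinatorics of longer representations. -/

namespace HasLongerRep

variable {A B C a b c a' b' c' : ℕ}

theorem mono (h : HasLongerRep A B C a b c) (ha : a ≤ a') (hb : b ≤ b') (hc : c ≤ c') :
    HasLongerRep A B C a' b' c' := by
  obtain ⟨p, q, r, h1, h2⟩ := h
  obtain ⟨i, rfl⟩ := Nat.exists_eq_add_of_le ha
  obtain ⟨j, rfl⟩ := Nat.exists_eq_add_of_le hb
  obtain ⟨l, rfl⟩ := Nat.exists_eq_add_of_le hc
  exact ⟨p + i, q + j, r + l, by linear_combination h1, by omega⟩

theorem not_left (hA : 0 < A) (hAB : A < B) (hBC : B < C) : ¬ HasLongerRep A B C a 0 0 := by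
  rintro ⟨p, q, r, h1, h2⟩
  nlinarith [Nat.mul_le_mul_left q hAB.le, Nat.mul_le_mul_left r (hAB.trans hBC).le,
    Nat.mul_le_mul_right A (Nat.succ_le_of_lt h2)]

theorem right_of_eq (hAB : A < B) (hBC : B < C) (hc : 0 < c) (h : a' * A + b' * B = c * C) :
    HasLongerRep A B C 0 0 c := by
  refine ⟨a', b', 0, by linear_combination h, ?_⟩
  by_contra hlt
  have h1 : a' + b' ≤ c := by omega
  have h2 : a' * A + b' * B ≤ (a' + b') * B := by nlinarith [Nat.mul_le_mul_left a' hAB.le]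
  have h3 : (a' + b') * B ≤ c * B := Nat.mul_le_mul_right _ h1
  have h4 : c * B < c * C := Nat.mul_lt_mul_of_pos_left hBC hc
  omega

/-- If the longer representation uses at least as many copies of A, or of B, these cancel. Otherwise
cancellation leaves iA + jB = lC with l > i + j, impossible because C is the largest weight. -/
theorem left_or_middle (hAB : A < B) (hBC : B < C) (h : HasLongerRep A B C a b c) :
    HasLongerRep A B C 0 b c ∨ HasLongerRep A B C a 0 c := by
  obtain ⟨p, q, r, h1, h2⟩ := h
  by_cases hp : a ≤ p
  · obtain ⟨i, rfl⟩ := Nat.exists_eq_add_of_le hp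
    exact Or.inl ⟨i, q, r, by linarith, by omega⟩
  by_cases hq : b ≤ q
  · obtain ⟨i, rfl⟩ := Nat.exists_eq_add_of_le hq
    exact Or.inr ⟨p, i, r, by linarith, by omega⟩
  exfalso
  obtain ⟨i, rfl⟩ := Nat.exists_eq_add_of_le (not_le.mp hp).le
  obtain ⟨j, rfl⟩ := Nat.exists_eq_add_of_le (not_le.mp hq).le
  have h3 : c ≤ r := by omega
  obtain ⟨l, rfl⟩ := Nat.exists_eq_add_of_le h3
  have h4 : i + j < l := by omega
  nlinarith [Nat.mul_le_mul_left i (hAB.trans hBC).le, Nat.mul_le_mul_left j hBC.le,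
    Nat.mul_le_mul_right C (Nat.succ_le_of_lt h4)]

theorem exists_right (hAB : A < B) (hBC : B < C) :
    ∃ c, HasLongerRep A B C 0 0 c :=
  ⟨A, C, 0, 0, by ring, by omega⟩

theorem exists_middle (hAB : A < B) : ∃ b, HasLongerRep A B C 0 b 0 :=
  ⟨A, B, 0, 0, by ring, by omega⟩

/-- A representation of a monomial in the first and third variable, no factor of which has a longer
representation, only uses the second generator. -/
theorem eq_middle (h : HasLongerRep A B C (a + 1) 0 (c + 1))
    (ha : ¬ HasLongerRep A B C a 0 (c + 1)) (hc : ¬ HasLongerRep A B C (a + 1) 0 c) :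
    ∃ q, q * B = (a + 1) * A + (c + 1) * C := by
  obtain ⟨p, q, r, h1, h2⟩ := h
  rcases p with _ | p
  · rcases r with _ | r
    · exact ⟨q, by linarith⟩
    · exact absurd ⟨0, q, r, by linarith, by omega⟩ hc
  · exact absurd ⟨p, q, r, by linarith, by omega⟩ ha

/-- A representation of a monomial in the second and third variable, no factor of which has a longer
representation, only uses the first generator. -/
theorem eq_left (h : HasLongerRep A B C 0 (b + 1) (c + 1))
    (hb : ¬ HasLongerRep A B C 0 b (c + 1)) (hc : ¬ HasLongerRep A B C 0 (b + 1) c) :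
    ∃ p, p * A = (b + 1) * B + (c + 1) * C := by
  obtain ⟨p, q, r, h1, h2⟩ := h
  rcases q with _ | q
  · rcases r with _ | r
    · exact ⟨p, by linarith⟩
    · exact absurd ⟨p, 0, r, by linarith, by omega⟩ hc
  · exact absurd ⟨p, q, r, by linarith, by omega⟩ hb

open Classical in
/-- Under the Buchsbaum hypothesis `hT` the monomials `x ^ a * z ^ c` with a longer representation
are the multiples of one power of `z` and of one further monomial. -/
theorem exists_corner_left (hA : 0 < A) (hAB : A < B) (hBC : B < C)
    (hT : ∀ a c, HasLongerRep A B C a 0 c → HasLongerRep A B C 2 0 c)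
    {γ : ℕ} (hγ : ∀ c, HasLongerRep A B C 0 0 c → γ ≤ c) :
    ∃ a₁ c₁, HasLongerRep A B C a₁ 0 c₁ ∧
      ∀ a c, HasLongerRep A B C a 0 c → γ ≤ c ∨ (a₁ ≤ a ∧ c₁ ≤ c) := by
  have hex : ∃ c a, HasLongerRep A B C a 0 c := by
    obtain ⟨c, hc⟩ := exists_right hAB hBC
    exact ⟨c, 0, hc⟩
  obtain ⟨c₁, hc₁, hmin⟩ : ∃ c₁, (∃ a, HasLongerRep A B C a 0 c₁) ∧
      ∀ a c, HasLongerRep A B C a 0 c → c₁ ≤ c :=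
    ⟨Nat.find hex, Nat.find_spec hex, fun a c h => Nat.find_min' hex ⟨a, h⟩⟩
  refine ⟨Nat.find hc₁, c₁, Nat.find_spec hc₁, fun a c h => ?_⟩
  by_contra! hcon
  obtain ⟨hcγ, hlt⟩ := hcon
  have hc := hmin a c h
  have ha : a < Nat.find hc₁ := by
    by_contra! h1
    exact absurd (hlt h1) (by omega)
  -- At the least z-exponent the hypothesis bounds the x-exponent by 2, so a second corner below z^γ
  -- must have x-exponent 1 and the first one x-exponent 2.
  have h2 : HasLongerRep A B C 2 0 c₁ := hT _ _ (Nat.find_spec hc₁)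
  have ha2 : Nat.find hc₁ ≤ 2 := Nat.find_min' hc₁ h2
  have ha0 : a ≠ 0 := by
    rintro rfl
    exact absurd (hγ c h) (by omega)
  have hn1 : ¬ HasLongerRep A B C 1 0 c₁ := Nat.find_min hc₁ (by omega)
  have hex1 : ∃ c, HasLongerRep A B C 1 0 c := ⟨c, h.mono (by omega) le_rfl le_rfl⟩
  obtain ⟨d, hd, hdmin⟩ : ∃ d, HasLongerRep A B C 1 0 d ∧ ∀ c, HasLongerRep A B C 1 0 c → d ≤ c :=
    ⟨Nat.find hex1, Nat.find_spec hex1, fun c h => Nat.find_min' hex1 h⟩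
  have hdc : d ≤ c := hdmin c (h.mono (by omega) le_rfl le_rfl)
  have hd1 : c₁ ≤ d := hmin _ _ hd
  have hd2 : c₁ ≠ d := by
    rintro rfl
    exact hn1 hd
  obtain ⟨c₁, rfl⟩ : ∃ e, c₁ = e + 1 := by
    refine Nat.exists_eq_succ_of_ne_zero ?_
    rintro rfl
    exact not_left hA hAB hBC h2
  obtain ⟨d, rfl⟩ : ∃ e, d = e + 1 := ⟨d - 1, by omega⟩
  -- Both corners are minimal, so their weights are multiples of B. The difference of the two
  -- equations makes a power of z below z^γ vanish, or writes A as a sum involving the larger C.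
  obtain ⟨q, hq⟩ := eq_middle (a := 0) hd (fun h => absurd (hγ _ h) (by omega))
    (fun h => absurd (hdmin _ h) (by omega))
  obtain ⟨q', hq'⟩ := eq_middle (a := 1) h2 hn1 (fun h => absurd (hmin _ _ h) (by omega))
  obtain ⟨e, rfl⟩ := Nat.exists_eq_add_of_le (show c₁ ≤ d by omega)
  have he : 0 < e := by omega
  rcases le_total q' q with hqq | hqq
  · obtain ⟨f, rfl⟩ := Nat.exists_eq_add_of_le hqq
    have h5 : 1 * A + f * B = e * C := by linarith
    exact absurd (hγ _ (right_of_eq hAB hBC he h5)) (by omega)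
  · obtain ⟨f, rfl⟩ := Nat.exists_eq_add_of_le hqq
    have h5 : A = f * B + e * C := by linarith
    have := Nat.mul_le_mul_right C he
    omega

open Classical in
/-- Under the Buchsbaum hypothesis `hT` the monomials `y ^ b * z ^ c` with a longer representation
are, up to homogeneous binomials, the multiples of one power of `y`, one power of `z` and one further
monomial. -/
theorem exists_corner_right (hAB : A < B) (hBC : B < C)
    (hB : ∀ p q, p * A + q * C ≠ B)
    (hT : ∀ a c, HasLongerRep A B C a 0 c → ∀ i j l, i + j + l = 2 →
      HasLongerRep A B C i j (c + l))
    {β γ : ℕ} (hγ : ∀ c, HasLongerRep A B C 0 0 c → γ ≤ c) (hγ0 : 0 < γ)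
    (hβ : ∀ b, HasLongerRep A B C 0 b 0 → β ≤ b) :
    ∃ b₁ c₁, HasLongerRep A B C 0 b₁ c₁ ∧
      ∀ b c, HasLongerRep A B C 0 b c → γ ≤ c ∨ β ≤ b ∨ (b₁ ≤ b ∧ c₁ ≤ c) ∨
        ∃ p q r, q = p + r ∧ q * B = p * A + r * C ∧ 0 < q ∧ q < β ∧ b₁ + q ≤ b ∧ c₁ ≤ c + r := by
  -- Without the bound c < γ the least y-exponent would be 0, attained by z^γ itself.
  have hex : ∃ b c, c < γ ∧ HasLongerRep A B C 0 b c := by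
    obtain ⟨b, hb⟩ := exists_middle (C := C) hAB
    exact ⟨b, 0, hγ0, hb⟩
  obtain ⟨b₁, hb₁, hmin⟩ : ∃ b₁, (∃ c, c < γ ∧ HasLongerRep A B C 0 b₁ c) ∧
      ∀ b c, c < γ → HasLongerRep A B C 0 b c → b₁ ≤ b :=
    ⟨Nat.find hex, Nat.find_spec hex, fun b c h h' => Nat.find_min' hex ⟨c, h, h'⟩⟩
  obtain ⟨c₁, ⟨hc₁γ, hc₁⟩, hcmin⟩ : ∃ c₁, (c₁ < γ ∧ HasLongerRep A B C 0 b₁ c₁) ∧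
      ∀ c, HasLongerRep A B C 0 b₁ c → c₁ ≤ c := by
    refine ⟨Nat.find hb₁, Nat.find_spec hb₁, fun c h => ?_⟩
    by_contra! hlt
    exact Nat.find_min hb₁ hlt ⟨hlt.trans (Nat.find_spec hb₁).1, h⟩
  refine ⟨b₁, c₁, hc₁, fun b c h => ?_⟩
  by_contra! hcon
  obtain ⟨hcγ, hbβ, hlt, hcon⟩ := hcon
  have hb1 : b₁ ≤ b := hmin b c hcγ h
  have hc1 : c < c₁ := hlt hb1
  have hex2 : ∃ b, HasLongerRep A B C 0 b c := ⟨b, h⟩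
  obtain ⟨b₂, hb₂, hb₂min⟩ : ∃ b₂, HasLongerRep A B C 0 b₂ c ∧
      ∀ b, HasLongerRep A B C 0 b c → b₂ ≤ b :=
    ⟨Nat.find hex2, Nat.find_spec hex2, fun b h => Nat.find_min' hex2 h⟩
  have hex3 : ∃ c, HasLongerRep A B C 0 b₂ c := ⟨c, hb₂⟩
  obtain ⟨c₂, hc₂, hc₂min⟩ : ∃ c₂, HasLongerRep A B C 0 b₂ c₂ ∧
      ∀ c, HasLongerRep A B C 0 b₂ c → c₂ ≤ c :=
    ⟨Nat.find hex3, Nat.find_spec hex3, fun b h => Nat.find_min' hex3 h⟩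
  have hb₂b : b₂ ≤ b := hb₂min b h
  have hc₂c : c₂ ≤ c := hc₂min c hb₂
  have hb₁₂ : b₁ < b₂ := by
    refine lt_of_le_of_ne (hmin b₂ c hcγ hb₂) ?_
    rintro rfl
    exact absurd (hcmin _ hc₂) (by omega)
  have hc₂0 : c₂ ≠ 0 := by
    rintro rfl
    exact absurd (hβ _ hc₂) (by omega)
  have hb₁0 : b₁ ≠ 0 := by
    rintro rfl
    exact absurd (hγ _ hc₁) (by omega)
  obtain ⟨a₂, ha₂⟩ : ∃ p, p * A = b₂ * B + c₂ * C := by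
    obtain ⟨b', rfl⟩ : ∃ e, b₂ = e + 1 := ⟨b₂ - 1, by omega⟩
    obtain ⟨c', rfl⟩ : ∃ e, c₂ = e + 1 := ⟨c₂ - 1, by omega⟩
    exact eq_left hc₂
      (fun h => absurd (hb₂min _ (h.mono le_rfl le_rfl hc₂c)) (by omega))
      (fun h => absurd (hc₂min _ h) (by omega))
  obtain ⟨a₁, ha₁⟩ : ∃ p, p * A = b₁ * B + c₁ * C := by
    obtain ⟨b', rfl⟩ : ∃ e, b₁ = e + 1 := ⟨b₁ - 1, by omega⟩
    obtain ⟨c', rfl⟩ : ∃ e, c₁ = e + 1 := ⟨c₁ - 1, by omega⟩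
    exact eq_left hc₁
      (fun h => absurd (hmin _ _ hc₁γ h) (by omega))
      (fun h => absurd (hcmin _ h) (by omega))
  obtain ⟨q, rfl⟩ := Nat.exists_eq_add_of_le hb₁₂.le
  obtain ⟨r, rfl⟩ := Nat.exists_eq_add_of_le (hc₂c.trans hc1.le)
  have hr : 0 < r := by omega
  rcases le_total a₂ a₁ with haa | haa
  · obtain ⟨p, rfl⟩ := Nat.exists_eq_add_of_le haa
    have h5 : p * A + q * B = r * C := by linarith
    exact absurd (hγ _ (right_of_eq hAB hBC hr h5)) (by omega)
  obtain ⟨p, rfl⟩ := Nat.exists_eq_add_of_le haa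
  have h5 : q * B = p * A + r * C := by linarith
  -- For q < p + r the power y^q vanishes although q < β; equality is the homogeneous alternative
  -- already excluded. In the remaining case x^p z^r vanishes and the Buchsbaum hypothesis applies.
  rcases lt_trichotomy q (p + r) with hq | hq | hq
  · exact absurd (hβ q ⟨p, 0, r, by linarith, by omega⟩) (by omega)
  · exact absurd (hcon p q r hq h5 (by omega) (by omega) (by omega)) (by omega)
  have h6 : HasLongerRep A B C p 0 r := ⟨0, q, 0, by linarith, by omega⟩
  -- Now z^(r+2), y z^(r+1) and y^2 z^r vanish. As c₂ + r < γ ≤ r + 2, the first forces c₂ = 1; the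
  -- second forces b₁ = 1; the third yields another corner to compare with.
  have h7 : γ ≤ r + 2 := hγ _ (hT _ _ h6 0 0 2 rfl)
  obtain rfl : c₂ = 1 := by omega
  have h8 : HasLongerRep A B C 0 1 (r + 1) := hT _ _ h6 0 1 1 rfl
  obtain rfl : b₁ = 1 := le_antisymm (hmin _ _ (by omega) h8) (by omega)
  have hex4 : ∃ c, HasLongerRep A B C 0 2 c := ⟨r, hT _ _ h6 0 2 0 rfl⟩
  obtain ⟨c₃, hc₃, hc₃min⟩ : ∃ c₃, HasLongerRep A B C 0 2 c₃ ∧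
      ∀ c, HasLongerRep A B C 0 2 c → c₃ ≤ c :=
    ⟨Nat.find hex4, Nat.find_spec hex4, fun b h => Nat.find_min' hex4 h⟩
  have hc₃r : c₃ ≤ r := hc₃min _ (hT _ _ h6 0 2 0 rfl)
  have hq1 : q ≠ 1 := by
    rintro rfl
    exact hB p r (by linarith)
  have hc₃0 : c₃ ≠ 0 := by
    rintro rfl
    exact absurd (hβ _ hc₃) (by omega)
  obtain ⟨a₃, ha₃⟩ : ∃ p, p * A = 2 * B + c₃ * C := by
    obtain ⟨c', rfl⟩ : ∃ e, c₃ = e + 1 := ⟨c₃ - 1, by omega⟩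
    exact eq_left (b := 1) hc₃ (fun h => absurd (hcmin _ h) (by omega))
      (fun h => absurd (hc₃min _ h) (by omega))
  obtain ⟨e, rfl⟩ := Nat.exists_eq_add_of_le hc₃r
  -- Subtracting the weights of y z^(r+1) and y^2 z^c₃ either writes B as a combination of A and C
  -- or makes z^(1+e) vanish with 1 + e < γ.
  rcases le_total a₁ a₃ with haa | haa
  · obtain ⟨f, rfl⟩ := Nat.exists_eq_add_of_le haa
    exact hB f (1 + e) (by linarith)
  · obtain ⟨f, rfl⟩ := Nat.exists_eq_add_of_le haa
    have h9 : f * A + 1 * B = (1 + e) * C := by linarith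
    exact absurd (hγ _ (right_of_eq hAB hBC (by omega) h9)) (by omega)

end HasLongerRep

/-! ### Homogeneous binomials and the four generators. -/

/-- The homogeneous relations between `A < B < C` are the multiples of one of them. -/
theorem exists_homogeneous_relation {A B C : ℕ} (hAB : A < B) (hBC : B < C) :
    ∃ p q r : ℕ, q = p + r ∧ q * B = p * A + r * C ∧ 0 < q ∧
      ∀ p' q' r' : ℕ, q' = p' + r' → q' * B = p' * A + r' * C →
        ∃ m, p' = m * p ∧ q' = m * q ∧ r' = m * r := by
  obtain ⟨u, rfl⟩ := Nat.exists_eq_add_of_le hAB.le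
  obtain ⟨v, rfl⟩ := Nat.exists_eq_add_of_le hBC.le
  have hu : 0 < u := by omega
  have hv : 0 < v := by omega
  -- With u = B - A and v = C - B a homogeneous relation reads pu = rv; the primitive one is p =
  -- v/g, r = u/g.
  obtain ⟨g, r, p, hg, hco, rfl, rfl⟩ := Nat.exists_coprime' (Nat.gcd_pos_of_pos_left v hu)
  have hr : 0 < r := Nat.pos_of_mul_pos_right hu
  refine ⟨p, p + r, r, rfl, by ring, by omega, ?_⟩
  rintro p' q' r' rfl h
  have h1 : p' * r = r' * p := by
    have h2 : g * (p' * r) = g * (r' * p) := by linarith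
    exact Nat.eq_of_mul_eq_mul_left hg h2
  have h3 : r ∣ r' := hco.dvd_of_dvd_mul_right (Dvd.intro_left p' h1)
  obtain ⟨m, rfl⟩ := h3
  have h4 : p' = m * p := Nat.eq_of_mul_eq_mul_right hr (by linarith)
  exact ⟨m, h4, by rw [h4]; ring, by ring⟩

/-- The ideal generated by the monomials in `x, y, z` whose weight has a longer representation, and
by the differences of monomials of the same degree and weight. -/
def monomialBinomialIdeal {R : Type*} [CommRing R] (A B C : ℕ) (x y z : R) : Ideal R :=
  Ideal.span ({f | ∃ a b c, HasLongerRep A B C a b c ∧ f = x ^ a * y ^ b * z ^ c} ∪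
    {f | ∃ a b c a' b' c', a + b + c = a' + b' + c' ∧
      a * A + b * B + c * C = a' * A + b' * B + c' * C ∧
      f = x ^ a * y ^ b * z ^ c - x ^ a' * y ^ b' * z ^ c'})

/-- Cancelling the common monomial leaves an m-fold multiple of the primitive relation, and X - Y
divides X^m - Y^m. -/
theorem binomial_mem_of_relation_mem {R : Type*} [CommRing R] {A B C : ℕ} {x y z : R} {N : Ideal R}
    {p q r : ℕ}
    (hrel : ∀ p' q' r' : ℕ, q' = p' + r' → q' * B = p' * A + r' * C →
      ∃ m, p' = m * p ∧ q' = m * q ∧ r' = m * r)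
    (hN : x ^ p * z ^ r - y ^ q ∈ N) {a b c a' b' c' : ℕ} (hAB : A < B) (hBC : B < C)
    (hd : a + b + c = a' + b' + c')
    (hw : a * A + b * B + c * C = a' * A + b' * B + c' * C) :
    x ^ a * y ^ b * z ^ c - x ^ a' * y ^ b' * z ^ c' ∈ N := by
  wlog hb : b ≤ b' generalizing a b c a' b' c'
  · rw [← neg_sub]
    exact N.neg_mem (this hd.symm hw.symm (not_le.mp hb).le)
  obtain ⟨j, rfl⟩ := Nat.exists_eq_add_of_le hb
  -- Since B lies strictly between A and C, a gain in y at constant degree and weight must be paid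
  -- for by both x and z.
  have ha : a' ≤ a := by
    by_contra! hlt
    obtain ⟨i, rfl⟩ := Nat.exists_eq_add_of_le hlt.le
    obtain ⟨l, rfl⟩ : ∃ l, c = c' + l := ⟨c - c', by omega⟩
    obtain rfl : l = i + j := by omega
    have hi : 0 < i := by omega
    nlinarith [Nat.mul_le_mul_left j hBC.le, Nat.mul_lt_mul_of_pos_left (hAB.trans hBC) hi]
  obtain ⟨i, rfl⟩ := Nat.exists_eq_add_of_le ha
  have hc : c' ≤ c := by
    by_contra! hlt
    obtain ⟨l, rfl⟩ := Nat.exists_eq_add_of_le hlt.le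
    obtain rfl : i = l + j := by omega
    have hl : 0 < l := by omega
    nlinarith [Nat.mul_le_mul_left j hAB.le, Nat.mul_lt_mul_of_pos_left (hAB.trans hBC) hl]
  obtain ⟨l, rfl⟩ := Nat.exists_eq_add_of_le hc
  obtain ⟨m, rfl, rfl, rfl⟩ := hrel i j l (by omega) (by linarith)
  have h1 : x ^ (a' + m * p) * y ^ b * z ^ (c' + m * r) - x ^ a' * y ^ (b + m * q) * z ^ c' =
      x ^ a' * y ^ b * z ^ c' * ((x ^ p * z ^ r) ^ m - (y ^ q) ^ m) := by
    simp only [mul_pow, ← pow_mul, pow_add, mul_comm m]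
    ring
  rw [h1]
  exact N.mul_mem_left _ (N.mem_of_dvd (sub_dvd_pow_sub_pow _ _ m) hN)

theorem monomial_mem_of_le {R : Type*} [CommRing R] {x y z : R} {N : Ideal R}
    {a b c a' b' c' : ℕ} (h : x ^ a * y ^ b * z ^ c ∈ N) (ha : a ≤ a') (hb : b ≤ b')
    (hc : c ≤ c') : x ^ a' * y ^ b' * z ^ c' ∈ N :=
  N.mem_of_dvd (mul_dvd_mul (mul_dvd_mul (pow_dvd_pow x ha) (pow_dvd_pow y hb))
    (pow_dvd_pow z hc)) h

open Classical in
/-- Under the Buchsbaum hypothesis `hT` the ideal of monomials and binomials is generated by four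
elements. -/
theorem exists_four_generators {R : Type*} [CommRing R] {A B C : ℕ} (x y z : R)
    (hA : 0 < A) (hAB : A < B) (hBC : B < C) (hB : ∀ p q, p * A + q * C ≠ B)
    (hT : ∀ a c, HasLongerRep A B C a 0 c → ∀ i j l, i + j + l = 2 →
      HasLongerRep A B C i j (c + l)) :
    ∃ g : Fin 4 → R, monomialBinomialIdeal A B C x y z = Ideal.span (Set.range g) := by
  have hexγ := HasLongerRep.exists_right hAB hBC
  obtain ⟨γ, hγ', hγ⟩ : ∃ γ, HasLongerRep A B C 0 0 γ ∧ ∀ c, HasLongerRep A B C 0 0 c → γ ≤ c :=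
    ⟨Nat.find hexγ, Nat.find_spec hexγ, fun c h => Nat.find_min' hexγ h⟩
  have hexβ := HasLongerRep.exists_middle (C := C) hAB
  obtain ⟨β, hβ', hβ⟩ : ∃ β, HasLongerRep A B C 0 β 0 ∧ ∀ b, HasLongerRep A B C 0 b 0 → β ≤ b :=
    ⟨Nat.find hexβ, Nat.find_spec hexβ, fun c h => Nat.find_min' hexβ h⟩
  have hγ0 : 0 < γ := by
    refine Nat.pos_of_ne_zero ?_
    rintro rfl
    exact HasLongerRep.not_left hA hAB hBC hγ'
  obtain ⟨a₁, c₁, h₁, hcorner₁⟩ := HasLongerRep.exists_corner_left hA hAB hBC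
    (fun a c h => hT a c h 2 0 0 rfl) hγ
  obtain ⟨b₂, c₂, h₂, hcorner₂⟩ := HasLongerRep.exists_corner_right hAB hBC hB hT hγ hγ0 hβ
  obtain ⟨p, q, r, hpqr, hw, hq, hrel⟩ := exists_homogeneous_relation hAB hBC
  -- If y^q vanishes, so does x^p z^r, and y^β makes the binomial redundant; otherwise the binomial
  -- recovers y^β.
  let g : Fin 4 → R := ![x ^ 0 * y ^ 0 * z ^ γ, x ^ a₁ * y ^ 0 * z ^ c₁, x ^ 0 * y ^ b₂ * z ^ c₂,
    if HasLongerRep A B C 0 q 0 then x ^ 0 * y ^ β * z ^ 0 else x ^ p * z ^ r - y ^ q]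
  refine ⟨g, le_antisymm ?_ ?_⟩
  · set N := Ideal.span (Set.range g)
    have hmem (i : Fin 4) : g i ∈ N := Ideal.subset_span ⟨i, rfl⟩
    have hxz (a c : ℕ) (h : HasLongerRep A B C a 0 c) : x ^ a * y ^ 0 * z ^ c ∈ N := by
      rcases hcorner₁ a c h with h1 | ⟨h1, h2⟩
      · exact monomial_mem_of_le (hmem 0) (Nat.zero_le a) le_rfl h1
      · exact monomial_mem_of_le (hmem 1) h1 le_rfl h2
    have hyz (b c : ℕ) (hb : b < β) (h : HasLongerRep A B C 0 b c) :
        x ^ 0 * y ^ b * z ^ c ∈ N := by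
      rcases hcorner₂ b c h with h1 | h1 | ⟨h1, h2⟩ | ⟨p', q', r', h1, h2, h3, h4, h5, h6⟩
      · exact monomial_mem_of_le (hmem 0) le_rfl (Nat.zero_le b) h1
      · omega
      · exact monomial_mem_of_le (hmem 2) le_rfl h1 h2
      · obtain ⟨m, hm1, hm2, hm3⟩ := hrel p' q' r' h1 h2
        have hm : 1 ≤ m := by
          refine Nat.pos_of_ne_zero ?_
          rintro rfl
          omega
        have hq' : ¬ HasLongerRep A B C 0 q 0 := by
          intro h7
          have := hβ q h7
          have := Nat.mul_le_mul_right q hm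
          omega
        have hbin : x ^ p * z ^ r - y ^ q ∈ N := by
          have := hmem 3
          simpa [g, hq'] using this
        obtain ⟨s, rfl⟩ := Nat.exists_eq_add_of_le h5
        -- Trading y^q' for x^p' z^r' raises the z-exponent to at least c₂, so the new monomial is a
        -- multiple of the third generator.
        have h8 : x ^ 0 * y ^ (b₂ + q' + s) * z ^ c - x ^ p' * y ^ (b₂ + s) * z ^ (c + r') ∈ N :=
          binomial_mem_of_relation_mem hrel hbin hAB hBC (by omega) (by linarith)
        exact (N.sub_mem_iff_left (monomial_mem_of_le (hmem 2) (Nat.zero_le p')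
          (Nat.le_add_right b₂ s) h6)).mp h8
    have hlow (a b c : ℕ) (hb : b < β) (h : HasLongerRep A B C a b c) :
        x ^ a * y ^ b * z ^ c ∈ N := by
      rcases h.left_or_middle hAB hBC with h1 | h1
      · exact monomial_mem_of_le (hyz b c hb h1) (Nat.zero_le a) le_rfl le_rfl
      · exact monomial_mem_of_le (hxz a c h1) le_rfl (Nat.zero_le b) le_rfl
    have hboth : x ^ p * z ^ r - y ^ q ∈ N ∧ x ^ 0 * y ^ β * z ^ 0 ∈ N := by
      by_cases hq' : HasLongerRep A B C 0 q 0
      · have h1 : x ^ 0 * y ^ β * z ^ 0 ∈ N := by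
          have := hmem 3
          simpa [g, hq'] using this
        have h2 : x ^ 0 * y ^ q * z ^ 0 ∈ N := monomial_mem_of_le h1 le_rfl (hβ q hq') le_rfl
        have h3 : x ^ p * y ^ 0 * z ^ r ∈ N := by
          refine hxz p r ?_
          obtain ⟨a', b', c', h4, h5⟩ := hq'
          exact ⟨a', b', c', by linarith, by omega⟩
        exact ⟨by simpa using N.sub_mem h3 h2, h1⟩
      · have h1 : x ^ p * z ^ r - y ^ q ∈ N := by
          have := hmem 3
          simpa [g, hq'] using this
        refine ⟨h1, ?_⟩
        have hqβ : q < β := by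
          by_contra! h2
          exact hq' (hβ'.mono le_rfl h2 le_rfl)
        obtain ⟨s, rfl⟩ := Nat.exists_eq_add_of_le hqβ.le
        -- Modulo the binomial, y^β becomes a vanishing monomial of y-exponent s < β, to which
        -- `hlow` applies.
        have h2 : x ^ 0 * y ^ (q + s) * z ^ 0 - x ^ p * y ^ s * z ^ r ∈ N :=
          binomial_mem_of_relation_mem hrel h1 hAB hBC (by omega) (by linarith)
        refine (N.sub_mem_iff_left (hlow p s r (by omega) ?_)).mp h2
        obtain ⟨a', b', c', h4, h5⟩ := hβ'
        exact ⟨a', b', c', by linarith, by omega⟩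
    refine Ideal.span_le.mpr (Set.union_subset ?_ ?_)
    · rintro _ ⟨a, b, c, h, rfl⟩
      rcases lt_or_ge b β with hb | hb
      · exact hlow a b c hb h
      · exact monomial_mem_of_le hboth.2 (Nat.zero_le a) hb (Nat.zero_le c)
    · rintro _ ⟨a, b, c, a', b', c', hd, hw', rfl⟩
      exact binomial_mem_of_relation_mem hrel hboth.1 hAB hBC hd hw'
  · have hmono {a b c : ℕ} (h : HasLongerRep A B C a b c) :
        x ^ a * y ^ b * z ^ c ∈ monomialBinomialIdeal A B C x y z :=
      Ideal.subset_span (Or.inl ⟨a, b, c, h, rfl⟩)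
    rw [Ideal.span_le]
    rintro _ ⟨i, rfl⟩
    fin_cases i
    · exact hmono hγ'
    · exact hmono h₁
    · exact hmono h₂
    · change (if HasLongerRep A B C 0 q 0 then x ^ 0 * y ^ β * z ^ 0 else x ^ p * z ^ r - y ^ q) ∈
        monomialBinomialIdeal A B C x y z
      split_ifs
      · exact hmono hβ'
      · exact Ideal.subset_span (Or.inr ⟨p, 0, r, 0, q, 0, by omega, by linarith, by simp⟩)

/-! ### Rees algebra and associated graded ring. -/

section AssociatedGraded

variable {A : Type*} [CommRing A]

/-- The element `a Tⁱ` of the Rees algebra, for `a ∈ Jⁱ`. -/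
def reesMonomial (J : Ideal A) (i : ℕ) (a : A) (h : a ∈ J ^ i) : reesAlgebra J :=
  ⟨Polynomial.monomial i a, reesAlgebra.monomial_mem.mpr h⟩

/-- The degree one element `g i T` of the Rees algebra, for a family `g` in `J`. -/
def reesVar {J : Ideal A} {ι : Type*} {g : ι → A} (hg : ∀ i, g i ∈ J) (i : ι) : reesAlgebra J :=
  reesMonomial J 1 (g i) ((pow_one J).symm ▸ hg i)

theorem sum_reesMonomial {J : Ideal A} (p : reesAlgebra J) :
    p = ∑ i ∈ (p : Polynomial A).support,
      reesMonomial J i ((p : Polynomial A).coeff i) (p.2 i) := by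
  apply Subtype.ext
  rw [AddSubmonoidClass.coe_finsetSum]
  exact (p : Polynomial A).as_sum_support

theorem reesMonomial_add {J : Ideal A} {i : ℕ} {a b : A} (ha : a ∈ J ^ i) (hb : b ∈ J ^ i) :
    reesMonomial J i (a + b) (add_mem ha hb) = reesMonomial J i a ha + reesMonomial J i b hb :=
  Subtype.ext ((Polynomial.monomial i).map_add a b)

theorem reesMonomial_mul {J : Ideal A} {i j : ℕ} {a b : A} (ha : a ∈ J ^ i) (hb : b ∈ J ^ j) :
    reesMonomial J (i + j) (a * b) (pow_add J i j ▸ Ideal.mul_mem_mul ha hb) =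
      reesMonomial J i a ha * reesMonomial J j b hb :=
  Subtype.ext (Polynomial.monomial_mul_monomial i j a b).symm

theorem reesMonomial_zero_right {J : Ideal A} (i : ℕ) :
    reesMonomial J i 0 (Ideal.zero_mem _) = 0 :=
  Subtype.ext (Polynomial.monomial_zero_right i)

theorem algebraMap_mul_reesMonomial {J : Ideal A} {i : ℕ} (a : A) {b : A} (hb : b ∈ J ^ i) :
    algebraMap A (reesAlgebra J) a * reesMonomial J i b hb =
      reesMonomial J i (a * b) (Ideal.mul_mem_left _ a hb) :=
  Subtype.ext (Polynomial.C_mul_monomial ..)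

theorem grMk_surjective (J : Ideal A) : Function.Surjective (grMk J) :=
  Ideal.Quotient.mk_surjective

/-- For b in J and c in J^i, the element bc T^i is b times c T^i. The membership proof is an
argument of `reesMonomial`, so the induction carries it in an existential. -/
theorem grMk_reesMonomial_eq_zero {J : Ideal A} {i : ℕ} {a : A} (h : a ∈ J ^ (i + 1)) :
    grMk J (reesMonomial J i a (Ideal.pow_le_pow_right i.le_succ h)) = 0 := by
  suffices H : ∃ h' : a ∈ J ^ i, reesMonomial J i a h' ∈ J.map (algebraMap A (reesAlgebra J)) from
    Ideal.Quotient.eq_zero_iff_mem.mpr H.2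
  rw [pow_succ'] at h
  refine Submodule.mul_induction_on h (fun b hb c hc => ?_) ?_
  · refine ⟨Ideal.mul_mem_left _ b hc, ?_⟩
    rw [← algebraMap_mul_reesMonomial b hc]
    exact Ideal.mul_mem_right _ _ (Ideal.mem_map_of_mem _ hb)
  · rintro b c ⟨hb, hb'⟩ ⟨hc, hc'⟩
    exact ⟨add_mem hb hc, reesMonomial_add hb hc ▸ add_mem hb' hc'⟩

/-- Constants from J generate the kernel, and multiplying by degree-j elements of the Rees algebra
adds j to the order. This turns vanishing in gr into a bound on orders. -/
theorem coeff_mem_of_grMk_eq_zero {J : Ideal A} {p : reesAlgebra J} (h : grMk J p = 0) (i : ℕ) :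
    (p : Polynomial A).coeff i ∈ J ^ (i + 1) := by
  have h1 : p ∈ J.map (algebraMap A (reesAlgebra J)) := Ideal.Quotient.eq_zero_iff_mem.mp h
  clear h
  induction h1 using Submodule.span_induction generalizing i with
  | mem p hp =>
    obtain ⟨a, ha, rfl⟩ := hp
    change (Polynomial.C a).coeff i ∈ _
    rw [Polynomial.coeff_C]
    split_ifs with hi
    · subst hi
      simpa using ha
    · exact Ideal.zero_mem _
  | zero => exact Ideal.zero_mem _
  | add p q _ _ hp hq =>
    change ((p : Polynomial A) + (q : Polynomial A)).coeff i ∈ _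
    rw [Polynomial.coeff_add]
    exact add_mem (hp i) (hq i)
  | smul q p _ hp =>
    change ((q : Polynomial A) * (p : Polynomial A)).coeff i ∈ _
    rw [Polynomial.coeff_mul]
    refine Ideal.sum_mem _ fun x hx => ?_
    rw [← Finset.HasAntidiagonal.mem_antidiagonal.mp hx, add_assoc, pow_add]
    exact Ideal.mul_mem_mul (q.2 x.1) (hp x.2)

theorem reesVar_mem_span {J : Ideal A} {ι : Type*} {g : ι → A} (hg : ∀ i, g i ∈ J)
    (hJ : J ≤ Ideal.span (Set.range g)) {c : A} (hc : c ∈ J) :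
    reesMonomial J 1 c ((pow_one J).symm ▸ hc) ∈ Ideal.span (Set.range (reesVar hg)) := by
  suffices H : ∃ h, reesMonomial J 1 c h ∈ Ideal.span (Set.range (reesVar hg)) from H.2
  refine Submodule.span_induction ?_ ?_ ?_ ?_ (hJ hc)
  · rintro _ ⟨i, rfl⟩
    exact ⟨(pow_one J).symm ▸ hg i, Ideal.subset_span ⟨i, rfl⟩⟩
  · exact ⟨Ideal.zero_mem _, reesMonomial_zero_right (J := J) 1 ▸ Ideal.zero_mem _⟩
  · rintro b c - - ⟨hb, hb'⟩ ⟨hc, hc'⟩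
    exact ⟨add_mem hb hc, reesMonomial_add hb hc ▸ add_mem hb' hc'⟩
  · rintro a b - ⟨hb, hb'⟩
    exact ⟨Ideal.mul_mem_left _ a hb,
      algebraMap_mul_reesMonomial a hb ▸ Ideal.mul_mem_left _ _ hb'⟩

/-- The ideal of elements without degree-zero part is generated by the degree one classes of a
generating family of `J`. -/
theorem grIrrelevant_eq_span {J : Ideal A} {ι : Type*} {g : ι → A} (hg : ∀ i, g i ∈ J)
    (hJ : J ≤ Ideal.span (Set.range g)) :
    grIrrelevant J = Ideal.span (Set.range fun i => grMk J (reesVar hg i)) := by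
  have hr : (Set.range fun i => grMk J (reesVar hg i)) = grMk J '' Set.range (reesVar hg) :=
    Set.range_comp (grMk J) (reesVar hg)
  rw [hr, ← Ideal.map_span]
  refine congrArg (Ideal.map (grMk J)) (le_antisymm ?_ ?_)
  · intro p hp
    have h0 : (p : Polynomial A).coeff 0 = 0 := hp
    rw [sum_reesMonomial p]
    refine Ideal.sum_mem _ fun i hi => ?_
    obtain ⟨j, rfl⟩ : ∃ j, i = j + 1 := by
      refine Nat.exists_eq_succ_of_ne_zero ?_
      rintro rfl
      exact Polynomial.mem_support_iff.mp hi h0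
    suffices H : ∀ c ∈ J ^ j * J, ∃ h, reesMonomial J (j + 1) c h ∈
        Ideal.span (Set.range (reesVar hg)) from (H _ (pow_succ J j ▸ p.2 (j + 1))).2
    intro c hc
    refine Submodule.mul_induction_on hc (fun a ha b hb => ?_) ?_
    · have hb1 : b ∈ J ^ 1 := (pow_one J).symm ▸ hb
      exact ⟨pow_succ J j ▸ Ideal.mul_mem_mul ha hb,
        reesMonomial_mul ha hb1 ▸ Ideal.mul_mem_left _ _ (reesVar_mem_span hg hJ hb)⟩
    · rintro b c ⟨hb, hb'⟩ ⟨hc, hc'⟩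
      exact ⟨add_mem hb hc, reesMonomial_add hb hc ▸ add_mem hb' hc'⟩
  · rw [Ideal.span_le]
    rintro _ ⟨i, rfl⟩
    exact (Polynomial.coeff_monomial_of_ne (g i) (one_ne_zero).symm : _)

/-- If `A` is generated modulo `J` by a subring, then so is `gr_J(A)` by the image of this subring
and the degree one classes of a generating family of `J`. -/
theorem subring_eq_top_of_generators {J : Ideal A} {ι : Type*} {g : ι → A} (hg : ∀ i, g i ∈ J)
    (hJ : J ≤ Ideal.span (Set.range g)) (U : Subring (Gr J))
    (hU : ∀ a : A, ∃ b, a - b ∈ J ∧ grMk J (algebraMap A (reesAlgebra J) b) ∈ U)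
    (hgU : ∀ i, grMk J (reesVar hg i) ∈ U) : U = ⊤ := by
  have h0 (a : A) : grMk J (algebraMap A (reesAlgebra J) a) ∈ U := by
    obtain ⟨b, hab, hb⟩ := hU a
    have h1 : grMk J (algebraMap A (reesAlgebra J) (a - b)) = 0 :=
      Ideal.Quotient.eq_zero_iff_mem.mpr (Ideal.mem_map_of_mem _ hab)
    rw [map_sub, map_sub, sub_eq_zero] at h1
    rwa [h1]
  have h1 (c : A) (hc : c ∈ J) :
      ∃ h, grMk J (reesMonomial J 1 c h) ∈ U := by
    refine Submodule.span_induction ?_ ?_ ?_ ?_ (hJ hc)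
    · rintro _ ⟨i, rfl⟩
      exact ⟨(pow_one J).symm ▸ hg i, hgU i⟩
    · refine ⟨Ideal.zero_mem _, ?_⟩
      rw [reesMonomial_zero_right, map_zero]
      exact U.zero_mem
    · rintro b c - - ⟨hb, hb'⟩ ⟨hc, hc'⟩
      refine ⟨add_mem hb hc, ?_⟩
      rw [reesMonomial_add hb hc, map_add]
      exact U.add_mem hb' hc'
    · rintro a b - ⟨hb, hb'⟩
      refine ⟨Ideal.mul_mem_left _ a hb, ?_⟩
      have := U.mul_mem (h0 a) hb'
      rwa [← map_mul, algebraMap_mul_reesMonomial a hb] at this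
  have h2 (i : ℕ) (c : A) (hc : c ∈ J ^ i) : ∃ h, grMk J (reesMonomial J i c h) ∈ U := by
    induction i generalizing c with
    | zero => exact ⟨hc, h0 c⟩
    | succ j ih =>
      rw [pow_succ] at hc
      refine Submodule.mul_induction_on hc (fun a ha b hb => ?_) ?_
      · obtain ⟨ha', ha''⟩ := ih a ha
        obtain ⟨hb', hb''⟩ := h1 b hb
        refine ⟨pow_succ J j ▸ Ideal.mul_mem_mul ha hb, ?_⟩
        rw [reesMonomial_mul ha' hb', map_mul]
        exact U.mul_mem ha'' hb''
      · rintro b c ⟨hb, hb'⟩ ⟨hc, hc'⟩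
        refine ⟨add_mem hb hc, ?_⟩
        rw [reesMonomial_add hb hc, map_add]
        exact U.add_mem hb' hc'
  rw [eq_top_iff]
  rintro f -
  obtain ⟨p, rfl⟩ := grMk_surjective J f
  rw [sum_reesMonomial p, map_sum]
  exact U.sum_mem fun i _ => (h2 i _ (p.2 i)).2

theorem coe_prod_reesVar {J : Ideal A} {ι : Type*} {g : ι → A} (hg : ∀ i, g i ∈ J)
    (u : ι →₀ ℕ) :
    ((u.prod fun i e => reesVar hg i ^ e : reesAlgebra J) : Polynomial A) =
      Polynomial.monomial u.degree (u.prod fun i e => g i ^ e) := by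
  induction u using Finsupp.induction_linear with
  | zero => simp
  | add u v hu hv =>
    rw [Finsupp.prod_add_index' (fun _ => pow_zero _) (fun _ _ _ => pow_add _ _ _),
      Finsupp.prod_add_index' (fun _ => pow_zero _) (fun _ _ _ => pow_add _ _ _),
      Subalgebra.coe_mul, hu, hv, Polynomial.monomial_mul_monomial, map_add]
  | single i e =>
    rw [Finsupp.prod_single_index (h := fun i e => reesVar hg i ^ e) (pow_zero _),
      Finsupp.prod_single_index (h := fun i e => g i ^ e) (pow_zero _), Finsupp.degree_single, SubmonoidClass.coe_pow]
    change Polynomial.monomial 1 (g i) ^ e = _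
    rw [Polynomial.monomial_pow, one_mul]

theorem prod_mem_pow {J : Ideal A} {ι : Type*} {g : ι → A} (hg : ∀ i, g i ∈ J)
    (u : ι →₀ ℕ) : (u.prod fun i e => g i ^ e) ∈ J ^ u.degree := by
  have h := (u.prod fun i e => reesVar hg i ^ e).2 u.degree
  rwa [coe_prod_reesVar, Polynomial.coeff_monomial_same] at h

theorem prod_reesVar {J : Ideal A} {ι : Type*} {g : ι → A} (hg : ∀ i, g i ∈ J)
    (u : ι →₀ ℕ) :
    (u.prod fun i e => reesVar hg i ^ e) =
      reesMonomial J u.degree (u.prod fun i e => g i ^ e) (prod_mem_pow hg u) :=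
  Subtype.ext (coe_prod_reesVar hg u)

end AssociatedGraded

/-! ### Power series -/

section PowerSeries

/-- Induction on a set of variables that every term must meet: the terms free of x_s are covered by
the smaller set, and the rest is divisible by x_s. -/
theorem mem_idealN_of_constantCoeff_eq_zero {k : Type*} [Field k] {d : ℕ}
    {f : MvPowerSeries (Fin d) k} (hf : MvPowerSeries.constantCoeff f = 0) : f ∈ idealN k d := by
  classical
  suffices H : ∀ (T : Finset (Fin d)) (f : MvPowerSeries (Fin d) k),
      (∀ e : Fin d →₀ ℕ, (∀ i ∈ T, e i = 0) → MvPowerSeries.coeff e f = 0) → f ∈ idealN k d by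
    refine H Finset.univ f fun e he => ?_
    have : e = 0 := Finsupp.ext fun i => he i (Finset.mem_univ i)
    rw [this]
    exact hf
  intro T
  induction T using Finset.induction_on with
  | empty =>
    intro f h
    have : f = 0 := MvPowerSeries.ext fun e => h e (by simp)
    rw [this]
    exact Ideal.zero_mem _
  | insert s T _ ih =>
    intro f h
    let f₁ : MvPowerSeries (Fin d) k := fun e => if e s = 0 then MvPowerSeries.coeff e f else 0
    have hf₁ (e) : MvPowerSeries.coeff e f₁ = if e s = 0 then MvPowerSeries.coeff e f else 0 := rfl
    have h1 : f₁ ∈ idealN k d := by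
      refine ih f₁ fun e he => ?_
      rw [hf₁]
      split_ifs with hs
      · exact h e (Finset.forall_mem_insert _ _ _ |>.mpr ⟨hs, he⟩)
      · rfl
    have h2 : MvPowerSeries.X s ∣ f - f₁ := by
      rw [MvPowerSeries.X_dvd_iff]
      intro e he
      rw [map_sub, hf₁, if_pos he, sub_self]
    have h3 : f - f₁ ∈ idealN k d := Ideal.mem_of_dvd _ h2 (Ideal.subset_span ⟨s, rfl⟩)
    simpa using add_mem h3 h1

variable (k : Type*) [Field k] {d : ℕ} (n : Fin d → ℕ) (hn : ∀ i, 0 < n i)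

theorem prod_X_pow (u : Fin d →₀ ℕ) :
    (u.prod fun i e => (PowerSeries.X ^ n i : PowerSeries k) ^ e) =
      PowerSeries.X ^ Finsupp.weight n u := by
  rw [Finsupp.weight_apply, Finsupp.sum, Finsupp.prod, ← Finset.prod_pow_eq_pow_sum]
  refine Finset.prod_congr rfl fun i _ => ?_
  rw [← pow_mul, smul_eq_mul, mul_comm]

theorem coe_prod_toSemigroupRing_X (u : Fin d →₀ ℕ) :
    ((u.prod fun i e => toSemigroupRing k n hn (MvPowerSeries.X i) ^ e : semigroupRing k n hn) :
      PowerSeries k) = PowerSeries.X ^ Finsupp.weight n u := by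
  rw [← prod_X_pow, Finsupp.prod, Finsupp.prod, SubmonoidClass.coe_finsetProd]
  refine Finset.prod_congr rfl fun i _ => ?_
  rw [SubmonoidClass.coe_pow, coe_toSemigroupRing_X]

theorem exists_weight_eq_of_coeff_ne_zero {f : semigroupRing k n hn} {s : ℕ}
    (hs : PowerSeries.coeff s (f : PowerSeries k) ≠ 0) :
    ∃ u : Fin d →₀ ℕ, Finsupp.weight n u = s := by
  obtain ⟨_, g, rfl⟩ := f
  change MvPowerSeries.coeff (Finsupp.single () s)
    (MvPowerSeries.substAlgHom (hasSubst_X_pow k n hn) g) ≠ 0 at hs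
  rw [MvPowerSeries.coe_substAlgHom, MvPowerSeries.coeff_subst (hasSubst_X_pow k n hn)] at hs
  obtain ⟨u, hu⟩ : ∃ u, MvPowerSeries.coeff u g • MvPowerSeries.coeff (Finsupp.single () s)
      (u.prod fun i e => (PowerSeries.X ^ n i : PowerSeries k) ^ e) ≠ 0 := by
    by_contra! h
    exact hs (by rw [finsum_congr h, finsum_zero])
  refine ⟨u, ?_⟩
  rw [prod_X_pow] at hu
  have h1 : PowerSeries.coeff s (PowerSeries.X ^ Finsupp.weight n u : PowerSeries k) ≠ 0 :=
    right_ne_zero_of_smul hu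
  rw [PowerSeries.coeff_X_pow] at h1
  by_contra h2
  exact h1 (if_neg fun h3 => h2 h3.symm)

theorem toSemigroupRing_X_mem (i : Fin d) :
    toSemigroupRing k n hn (MvPowerSeries.X i) ∈ idealM k n hn :=
  Ideal.subset_span ⟨i, rfl⟩

theorem X_mem_idealN (i : Fin d) : (MvPowerSeries.X i : MvPowerSeries (Fin d) k) ∈ idealN k d :=
  Ideal.subset_span ⟨i, rfl⟩

/-- The exponents of the elements of `𝔪 ^ j` have representations with at least `j` summands. -/
theorem exists_le_degree_of_mem_pow {j : ℕ} {f : semigroupRing k n hn}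
    (hf : f ∈ idealM k n hn ^ j) {s : ℕ} (hs : PowerSeries.coeff s (f : PowerSeries k) ≠ 0) :
    ∃ u : Fin d →₀ ℕ, Finsupp.weight n u = s ∧ j ≤ u.degree := by
  have hadd (j : ℕ) (f g : semigroupRing k n hn)
      (hf : ∀ s, PowerSeries.coeff s (f : PowerSeries k) ≠ 0 →
        ∃ u : Fin d →₀ ℕ, Finsupp.weight n u = s ∧ j ≤ u.degree)
      (hg : ∀ s, PowerSeries.coeff s (g : PowerSeries k) ≠ 0 →
        ∃ u : Fin d →₀ ℕ, Finsupp.weight n u = s ∧ j ≤ u.degree)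
      (s : ℕ) (hs : PowerSeries.coeff s ((f + g : semigroupRing k n hn) : PowerSeries k) ≠ 0) :
      ∃ u : Fin d →₀ ℕ, Finsupp.weight n u = s ∧ j ≤ u.degree := by
    by_cases h : PowerSeries.coeff s (f : PowerSeries k) = 0
    · refine hg s fun h' => hs ?_
      rw [Subalgebra.coe_add, map_add, h, h', add_zero]
    · exact hf s h
  -- Exponent vectors add under products, so the bounds add. The case i = 0 later handles arbitrary
  -- coefficients from R.
  have hmul (i j : ℕ) (f g : semigroupRing k n hn)
      (hf : ∀ s, PowerSeries.coeff s (f : PowerSeries k) ≠ 0 →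
        ∃ u : Fin d →₀ ℕ, Finsupp.weight n u = s ∧ i ≤ u.degree)
      (hg : ∀ s, PowerSeries.coeff s (g : PowerSeries k) ≠ 0 →
        ∃ u : Fin d →₀ ℕ, Finsupp.weight n u = s ∧ j ≤ u.degree)
      (s : ℕ) (hs : PowerSeries.coeff s ((f * g : semigroupRing k n hn) : PowerSeries k) ≠ 0) :
      ∃ u : Fin d →₀ ℕ, Finsupp.weight n u = s ∧ i + j ≤ u.degree := by
    rw [Subalgebra.coe_mul, PowerSeries.coeff_mul] at hs
    obtain ⟨x, hx, hx'⟩ := Finset.exists_ne_zero_of_sum_ne_zero hs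
    obtain ⟨u, hu, hu'⟩ := hf x.1 (left_ne_zero_of_mul hx')
    obtain ⟨v, hv, hv'⟩ := hg x.2 (right_ne_zero_of_mul hx')
    exact ⟨u + v, by rw [map_add, hu, hv, Finset.HasAntidiagonal.mem_antidiagonal.mp hx],
      by rw [map_add]; exact add_le_add hu' hv'⟩
  induction j generalizing f s with
  | zero =>
    obtain ⟨u, hu⟩ := exists_weight_eq_of_coeff_ne_zero k n hn hs
    exact ⟨u, hu, Nat.zero_le _⟩
  | succ j ih =>
    rw [pow_succ] at hf
    suffices H : ∀ s, PowerSeries.coeff s (f : PowerSeries k) ≠ 0 →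
        ∃ u : Fin d →₀ ℕ, Finsupp.weight n u = s ∧ j + 1 ≤ u.degree from H s hs
    refine Submodule.mul_induction_on hf (fun a ha b hb => ?_) (hadd _)
    intro s
    refine hmul j 1 a b (fun s => ih ha) ?_ s
    refine Submodule.span_induction ?_ ?_ (fun f g _ _ => hadd _ f g) ?_ hb
    · rintro _ ⟨i, rfl⟩ s hs
      refine ⟨Finsupp.single i 1, ?_, by simp⟩
      rw [coe_toSemigroupRing_X, PowerSeries.coeff_X_pow] at hs
      rw [Finsupp.weight_single, one_smul]
      by_contra h
      exact hs (if_neg fun h' => h h'.symm)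
    · intro s hs
      exact absurd (map_zero _) hs
    · intro a x _ hx s hs
      simpa using hmul 0 1 a x (fun s hs => by
        obtain ⟨u, hu⟩ := exists_weight_eq_of_coeff_ne_zero k n hn hs
        exact ⟨u, hu, Nat.zero_le _⟩) hx s hs

/-- The monomial `∏ (t ^ nᵢ) ^ uᵢ` vanishes in the associated graded ring if and only if its weight
has a representation with more summands. -/
theorem prod_grMk_reesVar_eq_zero_iff (u : Fin d →₀ ℕ) :
    (u.prod fun i e => grMk (idealM k n hn) (reesVar (toSemigroupRing_X_mem k n hn) i) ^ e) = 0 ↔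
      ∃ v : Fin d →₀ ℕ, Finsupp.weight n v = Finsupp.weight n u ∧ u.degree < v.degree := by
  have h : (u.prod fun i e => grMk (idealM k n hn) (reesVar (toSemigroupRing_X_mem k n hn) i) ^ e) =
      grMk (idealM k n hn) (u.prod fun i e => reesVar (toSemigroupRing_X_mem k n hn) i ^ e) := by
    simp [Finsupp.prod]
  rw [h]
  constructor
  · intro h
    have h1 := coeff_mem_of_grMk_eq_zero h u.degree
    rw [coe_prod_reesVar, Polynomial.coeff_monomial_same] at h1
    obtain ⟨v, hv, hv'⟩ := exists_le_degree_of_mem_pow k n hn h1 (s := Finsupp.weight n u) (by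
      rw [coe_prod_toSemigroupRing_X, PowerSeries.coeff_X_pow_self]
      exact one_ne_zero)
    exact ⟨v, hv, hv'⟩
  · rintro ⟨v, hv, hv'⟩
    rw [prod_reesVar]
    refine grMk_reesMonomial_eq_zero (Ideal.pow_le_pow_right hv' ?_)
    have : (u.prod fun i e => toSemigroupRing k n hn (MvPowerSeries.X i) ^ e) =
        v.prod fun i e => toSemigroupRing k n hn (MvPowerSeries.X i) ^ e := by
      apply Subtype.ext
      rw [coe_prod_toSemigroupRing_X, coe_prod_toSemigroupRing_X, hv]
    rw [this]
    exact prod_mem_pow (toSemigroupRing_X_mem k n hn) v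

end PowerSeries

/-! ### The initial form ideal. -/

section InitialFormIdeal

variable (k : Type*) [Field k] {d : ℕ} (n : Fin d → ℕ) (hn : ∀ i, 0 < n i)

/-- The presentation of `gr_𝔫(S)` as a polynomial ring over `k`. -/
def polyToGr (d : ℕ) : MvPolynomial (Fin d) k →+* Gr (idealN k d) :=
  MvPolynomial.eval₂Hom
    ((grMk (idealN k d)).comp ((algebraMap (MvPowerSeries (Fin d) k) (reesAlgebra (idealN k d))).comp
      MvPowerSeries.C))
    fun i => grMk (idealN k d) (reesVar (X_mem_idealN k) i)

/-- The homomorphism from the polynomial ring to the Rees algebra of `𝔪` sending the `i`-th variable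
to `t ^ nᵢ T`. -/
def polyToRees : MvPolynomial (Fin d) k →+* reesAlgebra (idealM k n hn) :=
  MvPolynomial.eval₂Hom
    ((algebraMap _ (reesAlgebra (idealM k n hn))).comp (algebraMap k (semigroupRing k n hn)))
    (reesVar (toSemigroupRing_X_mem k n hn))

theorem polyToGr_surjective : Function.Surjective (polyToGr k d) := by
  rw [← RingHom.range_eq_top]
  refine subring_eq_top_of_generators (X_mem_idealN k) le_rfl _ (fun a => ?_) fun i => ?_
  · refine ⟨MvPowerSeries.C (MvPowerSeries.constantCoeff a), ?_, ?_⟩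
    · exact mem_idealN_of_constantCoeff_eq_zero (by simp)
    · exact ⟨MvPolynomial.C (MvPowerSeries.constantCoeff a), MvPolynomial.eval₂Hom_C _ _ _⟩
  · exact ⟨MvPolynomial.X i, MvPolynomial.eval₂Hom_X' _ _ _⟩

theorem grMap_comp_polyToGr :
    (grMap (toSemigroupRing k n hn) (map_idealN_le k n hn)).comp (polyToGr k d) =
      (grMk (idealM k n hn)).comp (polyToRees k n hn) := by
  refine MvPolynomial.ringHom_ext (fun c => ?_) fun i => ?_
  · rw [RingHom.comp_apply, RingHom.comp_apply, polyToGr, polyToRees, MvPolynomial.eval₂Hom_C,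
      MvPolynomial.eval₂Hom_C]
    refine congrArg (grMk (idealM k n hn)) (Subtype.ext ?_)
    refine (Polynomial.map_C _).trans (congrArg Polynomial.C ?_)
    exact (paramHom k n hn).rangeRestrict.commutes c
  · rw [RingHom.comp_apply, RingHom.comp_apply, polyToGr, polyToRees, MvPolynomial.eval₂Hom_X',
      MvPolynomial.eval₂Hom_X']
    refine congrArg (grMk (idealM k n hn)) (Subtype.ext ?_)
    exact Polynomial.map_monomial _

/-- Each monomial maps to a scalar times t^weight T^degree, so a whole bidegree collapses onto a
single coefficient. -/
theorem coeff_polyToRees (p : MvPolynomial (Fin d) k) (i s : ℕ) :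
    PowerSeries.coeff s (((polyToRees k n hn p : Polynomial (semigroupRing k n hn)).coeff i :
      semigroupRing k n hn) : PowerSeries k) =
      ∑ u ∈ p.support with (u.degree, Finsupp.weight n u) = (i, s), p.coeff u := by
  have hmono (u : Fin d →₀ ℕ) (c : k) :
      PowerSeries.coeff s (((polyToRees k n hn (MvPolynomial.monomial u c) :
        Polynomial (semigroupRing k n hn)).coeff i : semigroupRing k n hn) : PowerSeries k) =
        if (u.degree, Finsupp.weight n u) = (i, s) then c else 0 := by
    have h1 : (polyToRees k n hn (MvPolynomial.monomial u c) :
        Polynomial (semigroupRing k n hn)) = Polynomial.C (algebraMap k _ c) *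
          Polynomial.monomial u.degree
            (u.prod fun i e => toSemigroupRing k n hn (MvPowerSeries.X i) ^ e) := by
      rw [polyToRees, MvPolynomial.eval₂Hom_monomial, Subalgebra.coe_mul, coe_prod_reesVar]
      rfl
    rw [h1, Polynomial.coeff_C_mul, Polynomial.coeff_monomial]
    by_cases hi : u.degree = i
    · rw [if_pos hi, Subalgebra.coe_mul, coe_prod_toSemigroupRing_X]
      change PowerSeries.coeff s (PowerSeries.C c * PowerSeries.X ^ Finsupp.weight n u) = _
      rw [PowerSeries.coeff_C_mul, PowerSeries.coeff_X_pow]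
      simp [hi, eq_comm]
    · rw [if_neg hi, mul_zero, if_neg fun h => hi (Prod.mk.inj h).1]
      exact map_zero _
  let F : MvPolynomial (Fin d) k →+ k :=
    (PowerSeries.coeff (R := k) s).toAddMonoidHom.comp
      ((semigroupRing k n hn).val.toAddMonoidHom.comp
        ((Polynomial.lcoeff (semigroupRing k n hn) i).toAddMonoidHom.comp
          ((reesAlgebra (idealM k n hn)).val.toAddMonoidHom.comp
            (polyToRees k n hn).toAddMonoidHom)))
  have hF (u : Fin d →₀ ℕ) (c : k) : F (MvPolynomial.monomial u c) =
      if (u.degree, Finsupp.weight n u) = (i, s) then c else 0 := hmono u c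
  change F p = _
  conv_lhs => rw [p.as_sum]
  rw [map_sum, Finset.sum_filter]
  exact Finset.sum_congr rfl fun u _ => hF u _

/-- The initial form ideal is contained in each ideal that contains the monomials whose weight has a
representation with more summands, and the differences of monomials of the same degree and
weight. -/
theorem initialFormIdeal_le {Q : Ideal (Gr (idealN k d))}
    (hmono : ∀ u v : Fin d →₀ ℕ, Finsupp.weight n v = Finsupp.weight n u → u.degree < v.degree →
      (u.prod fun i e => grMk (idealN k d) (reesVar (X_mem_idealN k) i) ^ e) ∈ Q)
    (hbin : ∀ u v : Fin d →₀ ℕ, Finsupp.weight n u = Finsupp.weight n v → u.degree = v.degree →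
      (u.prod fun i e => grMk (idealN k d) (reesVar (X_mem_idealN k) i) ^ e) -
        (v.prod fun i e => grMk (idealN k d) (reesVar (X_mem_idealN k) i) ^ e) ∈ Q) :
    initialFormIdeal k n hn ≤ Q := by
  classical
  intro f hf
  obtain ⟨p, rfl⟩ := polyToGr_surjective k f
  have h0 : grMk (idealM k n hn) (polyToRees k n hn p) = 0 := by
    have h1 := RingHom.congr_fun (grMap_comp_polyToGr k n hn) p
    exact h1.symm.trans hf
  set κ : k →+* Gr (idealN k d) :=
    (grMk (idealN k d)).comp ((algebraMap (MvPowerSeries (Fin d) k) (reesAlgebra (idealN k d))).comp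
      MvPowerSeries.C)
  set m : (Fin d →₀ ℕ) → Gr (idealN k d) :=
    fun u => u.prod fun i e => grMk (idealN k d) (reesVar (X_mem_idealN k) i) ^ e
  have hp : polyToGr k d p = ∑ u ∈ p.support, κ (p.coeff u) * m u :=
    MvPolynomial.eval₂_eq _ _ _
  rw [hp, ← Finset.sum_fiberwise_of_maps_to
    (g := fun u : Fin d →₀ ℕ => (u.degree, Finsupp.weight n u))
    (t := p.support.image fun u => (u.degree, Finsupp.weight n u))
    (fun u hu => Finset.mem_image_of_mem _ hu)]
  refine Ideal.sum_mem _ fun x hx => ?_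
  obtain ⟨v, -, rfl⟩ := Finset.mem_image.mp hx
  -- Within one bidegree, replace every monomial by a representative `m v` at the cost of binomials.
  -- The remaining scalar is a coefficient of the image in the Rees algebra; if it is nonzero, the
  -- weight of v has a longer representation.
  have h1 : ∑ u ∈ p.support with (u.degree, Finsupp.weight n u) = (v.degree, Finsupp.weight n v),
      κ (p.coeff u) * m u =
      ∑ u ∈ p.support with (u.degree, Finsupp.weight n u) = (v.degree, Finsupp.weight n v),
        κ (p.coeff u) * (m u - m v) +
      κ (∑ u ∈ p.support with (u.degree, Finsupp.weight n u) =
        (v.degree, Finsupp.weight n v), p.coeff u) * m v := by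
    rw [map_sum, Finset.sum_mul, ← Finset.sum_add_distrib]
    exact Finset.sum_congr rfl fun u _ => by ring
  rw [h1]
  refine add_mem (Ideal.sum_mem _ fun u hu => Ideal.mul_mem_left _ _ ?_) ?_
  · obtain ⟨h2, h3⟩ := Prod.mk.inj (Finset.mem_filter.mp hu).2
    exact hbin u v h3 h2
  · rw [← coeff_polyToRees k n hn]
    by_cases h2 : PowerSeries.coeff (Finsupp.weight n v) (((polyToRees k n hn p :
        Polynomial (semigroupRing k n hn)).coeff v.degree : semigroupRing k n hn) :
          PowerSeries k) = 0
    · rw [h2, map_zero, zero_mul]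
      exact Ideal.zero_mem _
    · obtain ⟨w, hw, hw'⟩ := exists_le_degree_of_mem_pow k n hn
        (coeff_mem_of_grMk_eq_zero h0 v.degree) h2
      exact Ideal.mul_mem_left _ _ (hmono v w hw hw')

theorem grMap_prod (u : Fin d →₀ ℕ) :
    grMap (toSemigroupRing k n hn) (map_idealN_le k n hn)
      (u.prod fun i e => grMk (idealN k d) (reesVar (X_mem_idealN k) i) ^ e) =
      u.prod fun i e => grMk (idealM k n hn) (reesVar (toSemigroupRing_X_mem k n hn) i) ^ e := by
  have h (i : Fin d) : grMap (toSemigroupRing k n hn) (map_idealN_le k n hn)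
      (grMk (idealN k d) (reesVar (X_mem_idealN k) i)) =
      grMk (idealM k n hn) (reesVar (toSemigroupRing_X_mem k n hn) i) :=
    congrArg (grMk (idealM k n hn)) (Subtype.ext (Polynomial.map_monomial _))
  simp [Finsupp.prod, h]

theorem prod_grMk_reesVar_eq_of_weight_eq {u v : Fin d →₀ ℕ}
    (hw : Finsupp.weight n u = Finsupp.weight n v) (hd : u.degree = v.degree) :
    (u.prod fun i e => grMk (idealM k n hn) (reesVar (toSemigroupRing_X_mem k n hn) i) ^ e) =
      v.prod fun i e => grMk (idealM k n hn) (reesVar (toSemigroupRing_X_mem k n hn) i) ^ e := by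
  have h (u : Fin d →₀ ℕ) :
      (u.prod fun i e => grMk (idealM k n hn) (reesVar (toSemigroupRing_X_mem k n hn) i) ^ e) =
      grMk (idealM k n hn) (u.prod fun i e => reesVar (toSemigroupRing_X_mem k n hn) i ^ e) := by
    simp [Finsupp.prod]
  rw [h, h]
  refine congrArg _ (Subtype.ext ?_)
  rw [coe_prod_reesVar, coe_prod_reesVar, hd]
  refine congrArg _ (Subtype.ext ?_)
  rw [coe_prod_toSemigroupRing_X, coe_prod_toSemigroupRing_X, hw]

end InitialFormIdeal

/-! ### Three generators and the Buchsbaum hypothesis. -/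

section ThreeGenerators

variable {k : Type*} [Field k] {n : Fin 3 → ℕ}

/-- The exponent vector `(a, b, c)`. -/
def exponent (a b c : ℕ) : Fin 3 →₀ ℕ :=
  Finsupp.equivFunOnFinite.symm ![a, b, c]

theorem exponent_eq (u : Fin 3 →₀ ℕ) : u = exponent (u 0) (u 1) (u 2) := by
  ext i
  fin_cases i <;> rfl

theorem exponent_prod {M : Type*} [CommMonoid M] (x : Fin 3 → M) (a b c : ℕ) :
    ((exponent a b c).prod fun i e => x i ^ e) = x 0 ^ a * x 1 ^ b * x 2 ^ c := by
  rw [Finsupp.prod_fintype _ _ fun i => pow_zero _, Fin.prod_univ_three]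
  rfl

theorem weight_exponent (a b c : ℕ) :
    Finsupp.weight n (exponent a b c) = a * n 0 + b * n 1 + c * n 2 := by
  rw [Finsupp.weight_eq_sum, Fin.sum_univ_three]
  rfl

theorem degree_exponent (a b c : ℕ) : (exponent a b c).degree = a + b + c := by
  rw [Finsupp.degree_eq_sum, Fin.sum_univ_three]
  rfl

theorem hasLongerRep_iff (a b c : ℕ) : HasLongerRep (n 0) (n 1) (n 2) a b c ↔
    ∃ v : Fin 3 →₀ ℕ, Finsupp.weight n v = Finsupp.weight n (exponent a b c) ∧
      (exponent a b c).degree < v.degree := by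
  constructor
  · rintro ⟨a', b', c', h1, h2⟩
    refine ⟨exponent a' b' c', ?_, ?_⟩
    · rw [weight_exponent, weight_exponent, h1]
    · rwa [degree_exponent, degree_exponent]
  · rintro ⟨v, h1, h2⟩
    rw [exponent_eq v, weight_exponent, weight_exponent] at h1
    rw [exponent_eq v, degree_exponent, degree_exponent] at h2
    exact ⟨v 0, v 1, v 2, h1, h2⟩

theorem initialFormIdeal_eq (hn : ∀ i, 0 < n i) :
    initialFormIdeal k n hn = monomialBinomialIdeal (n 0) (n 1) (n 2)
      (grMk (idealN k 3) (reesVar (X_mem_idealN k) 0))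
      (grMk (idealN k 3) (reesVar (X_mem_idealN k) 1))
      (grMk (idealN k 3) (reesVar (X_mem_idealN k) 2)) := by
  have hprod (a b c : ℕ) := exponent_prod
    (fun i => grMk (idealN k 3) (reesVar (X_mem_idealN k) i)) a b c
  refine le_antisymm (initialFormIdeal_le k n hn ?_ ?_) ?_
  · intro u v hw hd
    rw [exponent_eq u] at hw hd ⊢
    rw [hprod]
    exact Ideal.subset_span (Or.inl ⟨_, _, _, (hasLongerRep_iff _ _ _).mpr ⟨v, hw, hd⟩, rfl⟩)
  · intro u v hw hd
    rw [exponent_eq u, exponent_eq v] at hw hd ⊢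
    rw [weight_exponent, weight_exponent] at hw
    rw [degree_exponent, degree_exponent] at hd
    rw [hprod, hprod]
    exact Ideal.subset_span (Or.inr ⟨_, _, _, _, _, _, hd, hw, rfl⟩)
  · refine Ideal.span_le.mpr (Set.union_subset ?_ ?_)
    · rintro _ ⟨a, b, c, h, rfl⟩
      rw [← hprod]
      refine (grMap_prod k n hn _).trans ?_
      exact (prod_grMk_reesVar_eq_zero_iff k n hn _).mpr ((hasLongerRep_iff a b c).mp h)
    · rintro _ ⟨a, b, c, a', b', c', hd, hw, rfl⟩
      rw [← hprod, ← hprod]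
      refine (map_sub _ _ _).trans ?_
      rw [grMap_prod, grMap_prod, sub_eq_zero]
      refine prod_grMk_reesVar_eq_of_weight_eq k n hn ?_ ?_
      · rw [weight_exponent, weight_exponent, hw]
      · rw [degree_exponent, degree_exponent, hd]

/-- If `gr_𝔪(R)` is `2`-Buchsbaum and `x ^ a z ^ c` vanishes in it, then its homogeneous maximal
ideal kills `z ^ c` in two steps. -/
theorem hasLongerRep_of_isKBuchsbaum (hn : IsMinimalGeneratingSequence n)
    (hB : IsKBuchsbaum 2 (grIrrelevant (idealM k n hn.pos))) {a c : ℕ}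
    (h : HasLongerRep (n 0) (n 1) (n 2) a 0 c) {i j l : ℕ} (hijl : i + j + l = 2) :
    HasLongerRep (n 0) (n 1) (n 2) i j (c + l) := by
  set M := grIrrelevant (idealM k n hn.pos)
  set x : Fin 3 → Gr (idealM k n hn.pos) :=
    fun i => grMk (idealM k n hn.pos) (reesVar (toSemigroupRing_X_mem k n hn.pos) i)
  have hzero (a b c : ℕ) :
      x 0 ^ a * x 1 ^ b * x 2 ^ c = 0 ↔ HasLongerRep (n 0) (n 1) (n 2) a b c := by
    rw [hasLongerRep_iff, ← exponent_prod x, prod_grMk_reesVar_eq_zero_iff]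
  have hM : M = Ideal.span (Set.range x) :=
    grIrrelevant_eq_span (toSemigroupRing_X_mem k n hn.pos) le_rfl
  have h01 : n 0 < n 1 := hn.strictMono (by decide)
  have h02 : n 0 < n 2 := hn.strictMono (by decide)
  have htors : x 2 ^ c ∈ zerothLocalCohomology M := by
    have hfg : M.FG := hM ▸ Submodule.fg_span (Set.finite_range x)
    have hrad : M ≤ ((⊥ : Ideal (Gr (idealM k n hn.pos))).colon {x 2 ^ c}).radical := by
      rw [hM, Ideal.span_le]
      rintro _ ⟨i, rfl⟩
      rw [SetLike.mem_coe, Ideal.mem_radical_iff]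
      simp only [Submodule.mem_colon_singleton, Ideal.mem_bot, smul_eq_mul]
      -- The hypothesis supplies the power of x. For y and z, n 0 copies of a larger generator equal
      -- more copies of n 0, so the power n 0 always works.
      fin_cases i
      · exact ⟨a, by simpa using (hzero a 0 c).mpr h⟩
      · refine ⟨n 0, ?_⟩
        simpa using (hzero 0 (n 0) c).mpr ⟨n 1, 0, c, by ring, by omega⟩
      · refine ⟨n 0, ?_⟩
        change x 2 ^ n 0 * x 2 ^ c = 0
        rw [← pow_add]
        simpa using (hzero 0 0 (n 0 + c)).mpr ⟨n 2, 0, c, by ring, by omega⟩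
    obtain ⟨N, hN⟩ := Ideal.exists_pow_le_of_le_radical_of_fg hrad hfg
    refine ⟨N, fun y hy => ?_⟩
    simpa [Submodule.mem_colon_singleton] using hN hy
  have hxM (i : Fin 3) : x i ∈ M := hM ▸ Ideal.subset_span ⟨i, rfl⟩
  have h2 : x 0 ^ i * x 1 ^ j * x 2 ^ l ∈ M ^ 2 := by
    have h4 : M ^ 2 = M ^ i * M ^ j * M ^ l := by rw [← pow_add, ← pow_add, hijl]
    rw [h4]
    exact Ideal.mul_mem_mul (Ideal.mul_mem_mul (Ideal.pow_mem_pow (hxM 0) i)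
      (Ideal.pow_mem_pow (hxM 1) j)) (Ideal.pow_mem_pow (hxM 2) l)
  have h3 : x 0 ^ i * x 1 ^ j * x 2 ^ l * x 2 ^ c ∈ M ^ 2 * zerothLocalCohomology M :=
    Ideal.mul_mem_mul h2 htors
  rw [show M ^ 2 * zerothLocalCohomology M = ⊥ from hB, Ideal.mem_bot, mul_assoc, ← pow_add,
    add_comm l c] at h3
  exact (hzero _ _ _).mp h3

theorem IsMinimalGeneratingSequence.middle_ne (hn : IsMinimalGeneratingSequence n) (p q : ℕ) :
    p * n 0 + q * n 2 ≠ n 1 := by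
  intro h
  refine hn.minimal 1 (h ▸ ?_)
  refine add_mem ?_ ?_
  · rw [← smul_eq_mul]
    exact nsmul_mem (AddSubmonoid.subset_closure (Set.mem_image_of_mem n (by simp))) p
  · rw [← smul_eq_mul]
    exact nsmul_mem (AddSubmonoid.subset_closure (Set.mem_image_of_mem n (by simp))) q

end ThreeGenerators

end SemigroupRing

end

theorem mainTheorem9 {k : Type*} [Field k] [CharZero k] (n : Fin 3 → ℕ)
    (hn : SemigroupRing.IsMinimalGeneratingSequence n)
    (hB : SemigroupRing.IsKBuchsbaum 2
      (SemigroupRing.grIrrelevant (SemigroupRing.idealM k n hn.pos))) :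
    ∃ g : Fin 4 → SemigroupRing.Gr (SemigroupRing.idealN k 3),
      SemigroupRing.initialFormIdeal k n hn.pos = Ideal.span (Set.range g) := by
  rw [SemigroupRing.initialFormIdeal_eq]
  exact SemigroupRing.exists_four_generators _ _ _ (hn.pos 0) (hn.strictMono (by decide))
    (hn.strictMono (by decide)) hn.middle_ne
    fun a c h i j l hijl => SemigroupRing.hasLongerRep_of_isKBuchsbaum hn hB h hijl
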